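/- Let $d \ge 1$ be an integer, let $G=(V,E)$ be a finite simple graph, and let $u,v\in V$ be a pair of vertices; $G+uv$ denotes $G$ with the edge $uv$ added (so $G+uv=G$ if $uv\in E$). For a configuration $p:V\to\mathbb{C}^d$ put $m_{xy}(p)=\sum_{i=1}^d (p(x)_i-p(y)_i)^2$ for $x,y\in V$ and $m_{d,G}(p)=(m_{xy}(p))_{xy\in E}\in\mathbb{C}^E$. Call $p$ generic if its $d|V|$ coordinates satisfy no nonzero polynomial with rational coefficients, and call $(G,p)$ and $(G,q)$ equivalent if $m_{d,G}(p)=m_{d,G}(q)$. For $\mathbb{K}\in\{\mathbb{C},\mathbb{R}\}$, the pair $\{u,v\}$ is globally linked in $G$ in $\mathbb{K}^d$ if $m_{uv}(p)=m_{uv}(q)$ whenever $p,q:V\to\mathbb{K}^d$, $p$ is generic, and $(G,p)$ and $(G,q)$ are equivalent. Let $M_{d,G}\subseteq\mathbb{C}^E$ be the Zariski closure of the image of $m_{d,G}$, and let $r_d(G)$ be the rank of its algebraic matroid, that is, the largest size of a set $E_0\subseteq E$ such that the projection of $M_{d,G}$ to $\mathbb{C}^{E_0}$ is Zariski dense. The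 pair $\{u,v\}$ is $\mathcal{R}_d$-linked in $G$ if $r_d(G+uv)=r_d(G)$. A stress of $(G,p)$ is a vector $\omega\in\mathbb{C}^E$ with $\sum_{w:\,xw\in E}\omega(xw)\,(p(w)-p(x))=0$ for every $x\in V$. Let $K_1(G,p)$ be the linear space of all $q:V\to\mathbb{C}$ such that every stress of $(G,p)$ is also a stress of the one-dimensional framework $(G,q)$. The shared stress nullity of $G$ in $d$ dimensions is $\dim_{\mathbb{C}} K_1(G,p)$ for generic $p:V\to\mathbb{C}^d$ (this number is the same for every generic $p$). The pair $\{u,v\}$ is $d$-stress-linked in $G$ if it is $\mathcal{R}_d$-linked in $G$ and the shared stress nullities of $G+uv$ and of $G$ in $d$ dimensions are equal. Theorem. If $\{u,v\}$ is $d$-stress-linked in $G$, then $\{u,v\}$ is globally linked in $G$ in $\mathbb{C}^d$, and hence also in $\mathbb{R}^d$. -/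

import Mathlib

namespace StressLinked

section Configurations

variable {V : Type*} {K : Type*} [Field K] {d : ℕ}

/-- The squared-distance map `m_{uv}(p) = ∑ i, (p(u)_i - p(v)_i)^2`. Over `ℂ` this is the bilinear
(not the Hermitian) expression. -/
def sqDist (p : V → Fin d → K) (u v : V) : K :=
  ∑ i, (p u i - p v i) ^ 2

theorem sqDist_comm (p : V → Fin d → K) (u v : V) : sqDist p u v = sqDist p v u :=
  Finset.sum_congr rfl fun _ _ => by ring

/-- The edge measurement map `m_{d,G}`, sending a configuration to its vector of squared edge
lengths. -/
def measurementMap (G : SimpleGraph V) (p : V → Fin d → K) : G.edgeSet → K :=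
  fun e => Sym2.lift ⟨sqDist p, sqDist_comm p⟩ e.1

/-- The realizations `(G,p)` and `(G,q)` are equivalent. -/
def Equivalent (G : SimpleGraph V) (p q : V → Fin d → K) : Prop :=
  measurementMap G p = measurementMap G q

/-- A configuration is generic if its `|V| d` coordinates satisfy no nonzero polynomial with
rational coefficients. -/
def IsGeneric [CharZero K] (p : V → Fin d → K) : Prop :=
  AlgebraicIndependent ℚ fun x : V × Fin d => p x.1 x.2

/-- `{u,v}` is globally linked in `G` in `K^d` (used for `K = ℂ` and `K = ℝ`). -/
def GloballyLinked (K : Type*) [Field K] [CharZero K] (d : ℕ) (G : SimpleGraph V) (u v : V) :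
    Prop :=
  ∀ p q : V → Fin d → K, IsGeneric p → Equivalent G p q → sqDist p u v = sqDist q u v

end Configurations

section RigidityMatroid

/-- The Zariski closure of a subset of the affine space `ℂ^σ`: the set of common zeroes of all
polynomials vanishing on `X`. -/
def zariskiClosure {σ : Type*} (X : Set (σ → ℂ)) : Set (σ → ℂ) :=
  MvPolynomial.zeroLocus ℂ (MvPolynomial.vanishingIdeal ℂ X)

/-- Independence in the algebraic matroid of `X ⊆ ℂ^E`: the projection of `X` to `ℂ^{E₀}` is
Zariski dense. -/
def AlgMatroidIndep {E : Type*} (X : Set (E → ℂ)) (E₀ : Set E) : Prop :=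
  zariskiClosure ((fun (x : E → ℂ) (e : E₀) => x e) '' X) = Set.univ

/-- The rank of the algebraic matroid of `X ⊆ ℂ^E` (for `E` finite): the largest size of an
independent set. -/
noncomputable def algMatroidRank {E : Type*} (X : Set (E → ℂ)) : ℕ :=
  sSup {k | ∃ E₀ : Set E, AlgMatroidIndep X E₀ ∧ E₀.ncard = k}

variable {V : Type*}

/-- The `d`-dimensional measurement variety `M_{d,G}`. -/
def measurementVariety (d : ℕ) (G : SimpleGraph V) : Set (G.edgeSet → ℂ) :=
  zariskiClosure (Set.range fun p : V → Fin d → ℂ => measurementMap G p)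

/-- The rank `r_d(G)` of the `d`-dimensional generic rigidity matroid of `G`. -/
noncomputable def rigidityRank (d : ℕ) (G : SimpleGraph V) : ℕ :=
  algMatroidRank (measurementVariety d G)

/-- The graph `G + uv`. -/
def addEdge (G : SimpleGraph V) (u v : V) : SimpleGraph V :=
  G ⊔ SimpleGraph.edge u v

/-- `{u,v}` is `R_d`-linked in `G`. -/
def RigidityLinked (d : ℕ) (G : SimpleGraph V) (u v : V) : Prop :=
  rigidityRank d (addEdge G u v) = rigidityRank d G

end RigidityMatroid

section Stresses

variable {V : Type*} [Fintype V]

open Classical in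
/-- The space `S(G,p)` of equilibrium stresses: those `ω ∈ ℂ^E` with
`∑_{w : vw ∈ E} ω(vw) (p(w) - p(v)) = 0` at every vertex `v`. The configuration may take values in
any complex vector space `W`; it is used for `W = ℂ^d` and, for one-dimensional configurations,
`W = ℂ`. -/
def stressSpace {W : Type*} [AddCommGroup W] [Module ℂ W] (G : SimpleGraph V) (p : V → W) :
    Submodule ℂ (G.edgeSet → ℂ) where
  carrier := {ω | ∀ v, ∑ w, (if h : G.Adj v w then ω ⟨s(v, w), h⟩ • (p w - p v) else 0) = 0}
  zero_mem' := by simp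
  add_mem' := by
    intro a b ha hb v
    have := congrArg₂ (· + ·) (ha v) (hb v)
    simp only [← Finset.sum_add_distrib, add_zero] at this
    refine Eq.trans ?_ this
    refine Finset.sum_congr rfl fun w _ => ?_
    split_ifs <;> simp [add_smul]
  smul_mem' := by
    intro c a ha v
    have := congrArg (c • ·) (ha v)
    simp only [Finset.smul_sum, smul_zero] at this
    refine Eq.trans ?_ this
    refine Finset.sum_congr rfl fun w _ => ?_
    split_ifs <;> simp [mul_smul]

/-- The one-dimensional shared stress kernel `K_1(G,p)`: all one-dimensional configurations that
satisfy every stress of `(G,p)`. -/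
def sharedStressKernel {d : ℕ} (G : SimpleGraph V) (p : V → Fin d → ℂ) :
    Submodule ℂ (V → ℂ) where
  carrier := {q | stressSpace G p ≤ stressSpace G q}
  zero_mem' := by
    intro ω _ v
    simp
  add_mem' := by
    intro a b ha hb ω hω v
    have := congrArg₂ (· + ·) (ha hω v) (hb hω v)
    simp only [← Finset.sum_add_distrib, add_zero] at this
    refine Eq.trans ?_ this
    refine Finset.sum_congr rfl fun w _ => ?_
    split_ifs
    · simp only [Pi.add_apply, smul_eq_mul]; ring
    · simp
  smul_mem' := by
    intro c a ha ω hω v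
    have := congrArg (c • ·) (ha hω v)
    simp only [Finset.smul_sum, smul_zero] at this
    refine Eq.trans ?_ this
    refine Finset.sum_congr rfl fun w _ => ?_
    split_ifs
    · simp only [Pi.smul_apply, smul_eq_mul]; ring
    · simp

/-- The shared stress nullity of `G` in `d` dimensions: the dimension of `K_1(G,p)` for generic
`(G,p)` in `ℂ^d`. Generic configurations exist and the dimension is the same for all of them, so
the infimum is over a one-element set. -/
noncomputable def sharedStressNullity (d : ℕ) (G : SimpleGraph V) : ℕ :=
  sInf {k | ∃ p : V → Fin d → ℂ, IsGeneric p ∧ Module.finrank ℂ (sharedStressKernel G p) = k}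

/-- `{u,v}` is `d`-stress-linked in `G`. -/
def IsStressLinked (d : ℕ) (G : SimpleGraph V) (u v : V) : Prop :=
  RigidityLinked d G u v ∧ sharedStressNullity d (addEdge G u v) = sharedStressNullity d G

end Stresses

end StressLinked

/-! Let `p` be generic and `(G,q)` equivalent to `(G,p)`. Then every stress of `(G,p)` is a stress
of `(G,q)` (`stressSpace_le_of_equivalent`), so the coordinates of `q` lie in `K_1(G,p)`. Equal
nullities force `K_1(G+uv,p) = K_1(G,p)`, so every stress of `(G+uv,p)` is a stress of `(G+uv,q)`.
Since `uv` is linked, one such stress `ω` has `ω(uv) ≠ 0` (`exists_stress_ne_zero`). A stress is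
orthogonal to the squared lengths; subtracting this relation at `q` from that at `p` leaves only
`ω(uv) (m_uv(p) - m_uv(q)) = 0`.

Tangent space arguments are replaced by ring homomorphisms to dual numbers. By genericity, relations
among the edge lengths of `p` are polynomial identities, so they hold for `q + εq'`. This deforms
the ring generated by the edge lengths; formal smoothness in characteristic zero extends the
deformation to `ℂ`, hence to the coordinates of `p` (`exists_bracket_eq_of_equivalent`). -/

namespace StressLinked

open MvPolynomial

/-! ### Extending and restricting first order deformations of fields. -/

section Lifting

/-- An extension of fields of characteristic zero is formally smooth. -/
theorem formallySmooth_of_charZero (K L : Type*) [Field K] [CharZero K] [Field L] [Algebra K L] :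
    Algebra.FormallySmooth K L := by
  obtain ⟨s, hs⟩ := exists_isTranscendenceBasis K L
  have : Algebra.IsAlgebraic (IntermediateField.adjoin K (Set.range ((↑) : s → L))) L :=
    hs.isAlgebraic_field
  exact .of_algebraicIndependent_of_isSeparable hs.1

/-- Let `π : B → L` be a surjection with nilpotent kernel onto a field of characteristic zero. A
lift along `π` of the embedding of a subring `A` of `L` extends to a section of `π`. -/
theorem exists_section_extending {A B L : Type*} [CommRing A] [CommRing B] [Field L] [CharZero L]
    (π : B →+* L) (hπ : Function.Surjective π) (hker : IsNilpotent (RingHom.ker π))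
    (hunit : ∀ b, IsUnit (π b) → IsUnit b)
    (a : A →+* L) (ha : Function.Injective a) (D : A →+* B) (hD : ∀ x, π (D x) = a x) :
    ∃ Φ : L →+* B, (∀ z, π (Φ z) = z) ∧ ∀ x, Φ (a x) = D x := by
  have : IsDomain A := ha.isDomain a
  let K := FractionRing A
  let f : K →+* L := IsFractionRing.lift ha
  -- Nonzero elements of `A` go to units of `B`, so `D` extends to the fraction field `K`.
  have hD' : ∀ y : nonZeroDivisors A, IsUnit (D y) := fun y => hunit _ <| by
    rw [hD, isUnit_iff_ne_zero]
    exact fun h => nonZeroDivisors.coe_ne_zero y (ha (by rw [h, map_zero]))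
  let g : K →+* B := IsLocalization.lift (M := nonZeroDivisors A) hD'
  have hgf : π.comp g = f := by
    refine IsLocalization.ringHom_ext (nonZeroDivisors A) ?_
    ext x
    simp [f, g, hD, K]
  have : CharZero K := (f.charZero_iff f.injective).2 inferInstance
  let _ := f.toAlgebra
  let _ := g.toAlgebra
  have := formallySmooth_of_charZero K L
  let π' : B →ₐ[K] L := { π with commutes' := fun x => RingHom.congr_fun hgf x }
  -- The identity of `L` lifts through the nilpotent kernel; being `K`-linear, the lift extends `D`.
  let Φ := Algebra.FormallySmooth.liftOfSurjective (AlgHom.id K L) π' hπ hker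
  refine ⟨Φ, fun z => Algebra.FormallySmooth.liftOfSurjective_apply (AlgHom.id K L) π' hπ hker z,
    fun x => ?_⟩
  have h := Φ.commutes (algebraMap A K x)
  have h1 : algebraMap K L (algebraMap A K x) = a x := IsFractionRing.lift_algebraMap ha x
  have h2 : algebraMap K B (algebraMap A K x) = D x := IsLocalization.lift_eq hD' x
  rw [h1, h2] at h
  exact h

/-- A first order deformation of the embedding of a subring of a field `L` of characteristic zero
extends to a first order deformation of the identity of `L`. -/
theorem exists_dualNumber_lift {A L : Type*} [CommRing A] [Field L] [CharZero L]
    (a : A →+* L) (ha : Function.Injective a) (D : A →+* DualNumber L)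
    (hD : ∀ x, (D x).fst = a x) :
    ∃ Φ : L →+* DualNumber L, (∀ z, (Φ z).fst = z) ∧ ∀ x, Φ (a x) = D x := by
  refine exists_section_extending (TrivSqZeroExt.fstHom L L L).toRingHom
    (fun z => ⟨TrivSqZeroExt.inl z, rfl⟩) ⟨2, ?_⟩
    (fun b hb => TrivSqZeroExt.isUnit_iff_isUnit_fst.2 hb) a ha D hD
  rw [Submodule.zero_eq_bot, eq_bot_iff, sq, Ideal.mul_le]
  intro x hx y hy
  have hx : x.fst = 0 := hx
  have hy : y.fst = 0 := hy
  rw [Ideal.mem_bot]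
  ext <;> simp [hx, hy]

/-- A first order deformation of the identity of a field of characteristic zero that is constant
on a subring is constant on all elements that are algebraic over this subring. -/
theorem dualNumber_eq_inl_of_isAlgebraic {L : Type*} [Field L] [CharZero L]
    (Φ : L →+* DualNumber L) (hΦ : ∀ z, (Φ z).fst = z) {A : Subalgebra ℚ L}
    (hA : ∀ x ∈ A, Φ x = TrivSqZeroExt.inl x) {t : L} (ht : IsAlgebraic A t) :
    Φ t = TrivSqZeroExt.inl t := by
  -- The field of constants of `Φ`, over which `t` has a separable minimal polynomial `g`.
  let k : Subfield L :=
    { RingHom.eqLocus Φ (TrivSqZeroExt.inlHom L L) with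
      inv_mem' := fun x hx => by
        have hx : Φ x = TrivSqZeroExt.inl x := hx
        change Φ x⁻¹ = TrivSqZeroExt.inl x⁻¹
        rcases eq_or_ne x 0 with rfl | h0
        · simp
        · have hu : IsUnit (Φ x) := (isUnit_iff_ne_zero.2 h0).map Φ
          refine hu.mul_left_cancel ?_
          rw [← map_mul, hx, ← TrivSqZeroExt.inl_mul, mul_inv_cancel₀ h0, map_one,
            TrivSqZeroExt.inl_one] }
  have hk : ∀ x : k, Φ x = TrivSqZeroExt.inl (x : L) := fun x => x.2
  let : Algebra A k := (Subring.inclusion (S := A.toSubring) (T := k.toSubring)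
    fun x hx => hA x hx).toAlgebra
  have : IsScalarTower A k L := .of_algebraMap_eq fun _ => rfl
  have hinj : Function.Injective (algebraMap A k) := fun x y h =>
    Subtype.ext (congrArg (fun z : k => (z : L)) h)
  have htk : IsIntegral k t := (ht.extendScalars hinj).isIntegral
  let g := minpoly k t
  have hsep : g.Separable := (minpoly.irreducible htk).separable
  have hg : Polynomial.aeval t g = 0 := minpoly.aeval k t
  have hg' : Polynomial.aeval t (Polynomial.derivative g) ≠ 0 := hsep.aeval_derivative_ne_zero hg
  obtain ⟨s, hs⟩ : ∃ s, Φ t = TrivSqZeroExt.inl t + TrivSqZeroExt.inr s :=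
    ⟨(Φ t).snd, by ext <;> simp [hΦ]⟩
  -- `Φ` fixes the coefficients of `g`, so `0 = g(t + εs) = ε g'(t) s`, and `g'(t) ≠ 0` forces `s =
  -- 0`.
  have key : Φ (Polynomial.aeval t g) = Polynomial.eval₂
      ((TrivSqZeroExt.inlHom L L).comp k.subtype) (Φ t) g := by
    rw [Polynomial.aeval_def, Polynomial.hom_eval₂]
    congr 1
    ext1 x
    exact hk x
  have hsq : (TrivSqZeroExt.inr s : DualNumber L) ^ 2 = 0 := by
    rw [sq, TrivSqZeroExt.inr_mul_inr]
  rw [hg, map_zero, ← Polynomial.eval_map, hs, Polynomial.eval_add_of_sq_eq_zero _ _ _ hsq,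
    Polynomial.derivative_map, ← Polynomial.map_map, ← Polynomial.map_map] at key
  have hinl : (TrivSqZeroExt.inl t : DualNumber L) = TrivSqZeroExt.inlHom L L t := rfl
  have e1 : ∀ r : Polynomial k, (r.map k.subtype).eval t = Polynomial.aeval t r := fun r => by
    rw [Polynomial.eval_map]; rfl
  rw [hinl, Polynomial.eval_map_apply, Polynomial.eval_map_apply, e1, e1, hg, map_zero,
    zero_add] at key
  have h0 : Polynomial.aeval t (Polynomial.derivative g) * s = 0 := by
    simpa [or_comm] using (congrArg TrivSqZeroExt.snd key).symm
  rw [hs, (mul_eq_zero.1 h0).resolve_left hg', TrivSqZeroExt.inr_zero, add_zero]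

end Lifting

/-! ### Algebraic independence under base change and under automorphisms of `ℂ`. -/

section AlgebraicIndependence

open scoped TensorProduct

/-- Algebraic independence of polynomials with coefficients in a field `K` is not affected by
an extension of `K`. -/
theorem algebraicIndependent_map_iff {ι σ K L : Type*} [Field K] [Field L] [Algebra K L]
    (x : ι → MvPolynomial σ K) :
    AlgebraicIndependent L (fun i => map (algebraMap K L) (x i)) ↔ AlgebraicIndependent K x := by
  constructor
  · intro h
    refine AlgebraicIndependent.of_ringHom_of_comp_eq (algebraMap K L) (map (algebraMap K L)) h
      (algebraMap K L).injective ?_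
    ext
    simp
  · intro h
    let f : MvPolynomial ι K →ₐ[K] MvPolynomial σ K := aeval x
    have h1 : Function.Injective (Algebra.TensorProduct.map (AlgHom.id L L) f) :=
      Module.Flat.lTensor_preserves_injective_linearMap (M := L) f.toLinearMap h
    have h2 : (aeval fun i => map (algebraMap K L) (x i)) =
        ((algebraTensorAlgEquiv K L).toAlgHom.comp
          (Algebra.TensorProduct.map (AlgHom.id L L) f)).comp
          (algebraTensorAlgEquiv K L).symm.toAlgHom := by
      ext1 i
      simp [f]
    rw [algebraicIndependent_iff_injective_aeval, h2]
    exact ((algebraTensorAlgEquiv K L).injective.comp h1).comp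
      (algebraTensorAlgEquiv K L).symm.injective

open Cardinal in
/-- Any two finite algebraically independent families of complex numbers with the same index set
are conjugate under the automorphisms of the field `ℂ`. -/
theorem exists_ringEquiv_of_algebraicIndependent {ι : Type*} [Finite ι] {x y : ι → ℂ}
    (hx : AlgebraicIndependent ℚ x) (hy : AlgebraicIndependent ℚ y) :
    ∃ σ : ℂ ≃+* ℂ, ∀ i, σ (x i) = y i := by
  -- Removing a finite family from a transcendence basis of `ℂ` leaves continuum many elements, so
  -- both families extend to bases with the same index type.
  have hbasis : ∀ z : ι → ℂ, AlgebraicIndependent ℚ z → ∃ b : ι ⊕ ℂ → ℂ,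
      IsTranscendenceBasis ℚ b ∧ ∀ i, b (Sum.inl i) = z i := by
    intro z hz
    obtain ⟨s, hs, hb⟩ := exists_isTranscendenceBasis_superset hz.to_subtype_range
    have hun : ℵ₀ < #ℂ := by rw [Cardinal.mk_complex]; exact aleph0_lt_continuum
    have h1 : #ℂ = #s := IsAlgClosed.cardinal_eq_cardinal_transcendence_basis_of_aleph0_lt'
      _ hb (by simp) hun
    have h2 : #(Set.range z) + #(s \ Set.range z : Set ℂ) = #s := by
      rw [add_comm, mk_sdiff_add_mk hs]
    have h3 : #(s \ Set.range z : Set ℂ) = #ℂ := h1 ▸ eq_of_add_eq_of_aleph0_le h2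
      ((lt_aleph0_of_finite _).trans (h1 ▸ hun)) (h1 ▸ hun).le
    obtain ⟨f⟩ := Cardinal.eq.1 h3
    classical
    let κ : ι ⊕ ℂ ≃ s := ((Equiv.ofInjective z hz.injective).sumCongr f.symm).trans
      (Equiv.Set.sumDiffSubset hs)
    exact ⟨fun j => κ j, (isTranscendenceBasis_equiv' κ rfl).2 hb, fun i => rfl⟩
  obtain ⟨b, hb, hbx⟩ := hbasis x hx
  obtain ⟨c, hc, hcy⟩ := hbasis y hy
  have := IsAlgClosed.isAlgClosure_of_transcendence_basis b hb
  have := IsAlgClosed.isAlgClosure_of_transcendence_basis c hc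
  let e := hb.1.aevalEquiv.symm.trans hc.1.aevalEquiv
  have he : ∀ j, (e ⟨b j, Algebra.subset_adjoin ⟨j, rfl⟩⟩ : ℂ) = c j := by
    intro j
    have : hb.1.aevalEquiv (X j) = ⟨b j, Algebra.subset_adjoin ⟨j, rfl⟩⟩ :=
      Subtype.ext (by simp)
    simp only [e, AlgEquiv.trans_apply, ← this, AlgEquiv.symm_apply_apply]
    simp
  refine ⟨IsAlgClosure.equivOfEquiv ℂ ℂ e.toRingEquiv, fun i => ?_⟩
  have h := IsAlgClosure.equivOfEquiv_algebraMap ℂ ℂ e.toRingEquiv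
    ⟨b (Sum.inl i), Algebra.subset_adjoin ⟨_, rfl⟩⟩
  rw [← hbx, ← hcy, ← he]
  exact h

end AlgebraicIndependence

/-! ### Deformations of configurations and their effect on squared lengths. -/

section Deformations

variable {V : Type*} {d : ℕ}

/-- The squared length of a pair of vertices in a configuration. -/
def sqLength {K : Type*} [Field K] (p : V → Fin d → K) : Sym2 V → K :=
  Sym2.lift ⟨sqDist p, sqDist_comm p⟩

/-- The squared length of a pair of vertices as a polynomial in the coordinates of the
configuration. -/
noncomputable def lengthPoly (V : Type*) (d : ℕ) : Sym2 V → MvPolynomial (V × Fin d) ℚ :=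
  Sym2.lift ⟨fun x y => ∑ i, (X (x, i) - X (y, i)) ^ 2,
    fun _ _ => Finset.sum_congr rfl fun _ _ => by ring⟩

theorem aeval_lengthPoly {R : Type*} [CommRing R] [Algebra ℚ R] (P : V × Fin d → R) (x y : V) :
    aeval P (lengthPoly V d s(x, y)) = ∑ i, (P (x, i) - P (y, i)) ^ 2 := by
  simp [lengthPoly]

theorem aeval_lengthPoly_eq_sqLength {K : Type*} [Field K] [Algebra ℚ K] (p : V → Fin d → K)
    (e : Sym2 V) : aeval (fun z : V × Fin d => p z.1 z.2) (lengthPoly V d e) = sqLength p e := by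
  induction e with
  | _ x y => exact aeval_lengthPoly _ x y

/-- Half of the derivative of the squared length of `xy` at `p` in the direction `p'`. -/
def bracket {K : Type*} [Field K] (p p' : V → Fin d → K) (x y : V) : K :=
  ∑ i, (p x i - p y i) * (p' x i - p' y i)

theorem snd_sum_sq_sub {K : Type*} [Field K] (P : V → Fin d → DualNumber K) (x y : V) :
    (∑ i, (P x i - P y i) ^ 2).snd =
      2 * bracket (fun x i => (P x i).fst) (fun x i => (P x i).snd) x y := by
  rw [TrivSqZeroExt.snd_sum, bracket, Finset.mul_sum]
  refine Finset.sum_congr rfl fun i _ => ?_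
  rw [sq, TrivSqZeroExt.snd_mul]
  simp only [TrivSqZeroExt.fst_sub, TrivSqZeroExt.snd_sub, smul_eq_mul, op_smul_eq_smul]
  ring

/-- The image of a squared distance under a first order deformation of the identity. -/
theorem snd_map_sqDist {K : Type*} [Field K] (Φ : K →+* DualNumber K) (hΦ : ∀ z, (Φ z).fst = z)
    (p : V → Fin d → K) (x y : V) :
    (Φ (sqDist p x y)).snd = 2 * bracket p (fun x i => (Φ (p x i)).snd) x y := by
  have h := snd_sum_sq_sub (fun x i => Φ (p x i)) x y
  simp only [hΦ] at h
  rw [← h, sqDist]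
  simp

/-- If `p` is generic and `(G,q)` is equivalent to `(G,p)`, then every first order change of the
edge lengths at `q` is also a first order change of the edge lengths at `p`. -/
theorem exists_bracket_eq_of_equivalent {G : SimpleGraph V} {p q : V → Fin d → ℂ}
    (hp : IsGeneric p) (hpq : Equivalent G p q) (q' : V → Fin d → ℂ) :
    ∃ p' : V → Fin d → ℂ, ∀ x y, G.Adj x y → bracket p p' x y = bracket q q' x y := by
  let y : G.edgeSet → ℂ := fun e => sqLength p e
  let ℓ : G.edgeSet → MvPolynomial (V × Fin d) ℚ := fun e => lengthPoly V d e
  let Q : V × Fin d → DualNumber ℂ := fun z =>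
    TrivSqZeroExt.inl (q z.1 z.2) + TrivSqZeroExt.inr (q' z.1 z.2)
  have hQfst : ∀ f : MvPolynomial (V × Fin d) ℚ, (aeval Q f).fst = aeval (fun z : V × Fin d => q z.1 z.2) f := by
    intro f
    have : (TrivSqZeroExt.fstHom ℚ ℂ ℂ).comp (aeval Q) =
        aeval (fun z : V × Fin d => q z.1 z.2) := by
      ext z
      simp [Q]
    exact DFunLike.congr_fun this f
  let φ : MvPolynomial G.edgeSet ℚ →+* ℂ := (aeval y).toRingHom
  let ψ : MvPolynomial G.edgeSet ℚ →+* DualNumber ℂ := ((aeval Q).comp (aeval ℓ)).toRingHom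
  have hφ : ∀ f, φ f = aeval (fun z : V × Fin d => p z.1 z.2) (aeval ℓ f) := by
    intro f
    have : (aeval y : MvPolynomial G.edgeSet ℚ →ₐ[ℚ] ℂ) =
        (aeval (fun z : V × Fin d => p z.1 z.2)).comp (aeval ℓ) := by
      ext e
      simp [y, ℓ, aeval_lengthPoly_eq_sqLength]
    exact DFunLike.congr_fun this f
  have hψfst : ∀ f, (ψ f).fst = φ f := by
    intro f
    have : ((TrivSqZeroExt.fstHom ℚ ℂ ℂ).comp ((aeval Q).comp (aeval ℓ))) =
        (aeval y : MvPolynomial G.edgeSet ℚ →ₐ[ℚ] ℂ) := by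
      ext e
      have : sqLength q (e : Sym2 V) = sqLength p e := (congrFun hpq e).symm
      simp [y, ℓ, hQfst, aeval_lengthPoly_eq_sqLength, this]
    exact DFunLike.congr_fun this f
  -- A relation among the edge lengths of the generic `p` is an identity, so it survives at `q +
  -- εq'`; thus `ψ` descends to the image of `φ`.
  have hker : ∀ f ∈ RingHom.ker φ, ψ f = 0 := by
    intro f hf
    have h0 : aeval ℓ f = 0 := hp.eq_zero_of_aeval_eq_zero _ ((hφ f).symm.trans hf)
    change aeval Q (aeval ℓ f) = 0
    rw [h0, map_zero]
  obtain ⟨Φ, hΦ, hΦa⟩ := exists_dualNumber_lift (RingHom.kerLift φ) (RingHom.kerLift_injective φ)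
    (Ideal.Quotient.lift _ ψ hker) fun f => by
      obtain ⟨f, rfl⟩ := Ideal.Quotient.mk_surjective f
      exact hψfst f
  -- `Φ` sends `p` to `p + εp'` and the edge lengths of `p` to those of `q + εq'`; the `ε`-parts
  -- agree.
  refine ⟨fun x i => (Φ (p x i)).snd, fun x z hxz => ?_⟩
  have h := hΦa (Ideal.Quotient.mk _ (X ⟨s(x, z), hxz⟩))
  rw [RingHom.kerLift_mk, Ideal.Quotient.lift_mk] at h
  have h1 : φ (X ⟨s(x, z), hxz⟩) = sqDist p x z := by
    simp [φ, y, sqLength]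
  have h2 : ψ (X ⟨s(x, z), hxz⟩) = ∑ i, (Q (x, i) - Q (z, i)) ^ 2 := by
    simp [ψ, ℓ, aeval_lengthPoly]
  rw [h1, h2] at h
  have h3 := congrArg TrivSqZeroExt.snd h
  rw [snd_map_sqDist Φ hΦ, snd_sum_sq_sub (fun x i => Q (x, i))] at h3
  simpa [Q] using h3

/-- A first order deformation of a generic configuration that preserves the lengths in `S` also
preserves every length that is algebraic over those in `S`. -/
theorem bracket_eq_zero_of_isAlgebraic {p : V → Fin d → ℂ} (hp : IsGeneric p) {S : Set (Sym2 V)}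
    {u v : V} (h : IsAlgebraic (Algebra.adjoin ℚ (sqLength p '' S)) (sqDist p u v))
    (p' : V → Fin d → ℂ) (hp' : ∀ x y, s(x, y) ∈ S → bracket p p' x y = 0) :
    bracket p p' u v = 0 := by
  let P : V × Fin d → DualNumber ℂ := fun z =>
    TrivSqZeroExt.inl (p z.1 z.2) + TrivSqZeroExt.inr (p' z.1 z.2)
  -- Genericity says that evaluation at `p` is injective, so any `p + εp'` extends to a deformation
  -- of `ℂ`.
  obtain ⟨Φ, hΦ, hΦa⟩ := exists_dualNumber_lift
    (aeval fun z : V × Fin d => p z.1 z.2 : MvPolynomial (V × Fin d) ℚ →ₐ[ℚ] ℂ).toRingHom hp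
    (aeval P).toRingHom fun f => by
      have : (TrivSqZeroExt.fstHom ℚ ℂ ℂ).comp (aeval P) =
          aeval (fun z : V × Fin d => p z.1 z.2) := by
        ext z
        simp [P]
      exact DFunLike.congr_fun this f
  have hΦp : ∀ x i, (Φ (p x i)).snd = p' x i := by
    intro x i
    have := hΦa (X (x, i))
    simp only [AlgHom.toRingHom_eq_coe, RingHom.coe_coe, aeval_X] at this
    rw [this]
    simp [P]
  have hsnd : ∀ x y, (Φ (sqDist p x y)).snd = 2 * bracket p p' x y := by
    intro x y
    rw [snd_map_sqDist Φ hΦ]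
    simp only [hΦp]
  have hS : ∀ z ∈ Algebra.adjoin ℚ (sqLength p '' S), Φ z = TrivSqZeroExt.inl z := by
    have : Algebra.adjoin ℚ (sqLength p '' S) ≤ AlgHom.equalizer Φ.toRatAlgHom
        (TrivSqZeroExt.inlAlgHom ℚ ℂ ℂ) := by
      refine Algebra.adjoin_le ?_
      rintro _ ⟨e, he, rfl⟩
      change Φ (sqLength p e) = TrivSqZeroExt.inl (sqLength p e)
      induction e with
      | _ x y =>
        change Φ (sqDist p x y) = TrivSqZeroExt.inl (sqDist p x y)
        ext
        · rw [hΦ, TrivSqZeroExt.fst_inl]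
        · rw [hsnd, hp' x y he, mul_zero, TrivSqZeroExt.snd_inl]
    exact fun z hz => this hz
  have huv := hsnd u v
  rw [dualNumber_eq_inl_of_isAlgebraic Φ hΦ hS h, TrivSqZeroExt.snd_inl] at huv
  exact (mul_eq_zero.1 huv.symm).resolve_left two_ne_zero

end Deformations

/-! ### The rigidity matroid in terms of lengths at a generic configuration. -/

section Matroid

variable {V : Type*} {d : ℕ}

theorem zariskiClosure_eq_univ_iff {σ : Type*} (Y : Set (σ → ℂ)) :
    zariskiClosure Y = Set.univ ↔
      ∀ f : MvPolynomial σ ℂ, (∀ y ∈ Y, aeval y f = 0) → f = 0 := by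
  constructor
  · intro h f hf
    refine MvPolynomial.funext fun x => ?_
    have hx : x ∈ zariskiClosure Y := h ▸ Set.mem_univ x
    simpa using hx f hf
  · intro h
    refine Set.eq_univ_of_forall fun x f hf => ?_
    rw [h f hf, map_zero]

/-- At a generic configuration, independence in the algebraic matroid of the measurement variety
is algebraic independence of the squared edge lengths. -/
theorem algMatroidIndep_measurementVariety_iff {G : SimpleGraph V} {p : V → Fin d → ℂ}
    (hp : IsGeneric p) (E₀ : Set G.edgeSet) :
    AlgMatroidIndep (measurementVariety d G) E₀ ↔
      AlgebraicIndepOn ℚ (sqLength p) (Subtype.val '' E₀) := by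
  let ℓ : E₀ → MvPolynomial (V × Fin d) ℚ := fun e => lengthPoly V d e.1.1
  have h1 : AlgebraicIndepOn ℚ (sqLength p) (Subtype.val '' E₀) ↔
      AlgebraicIndependent ℚ (fun e : E₀ => sqLength p e.1.1) :=
    (algebraicIndependent_equiv' (Equiv.Set.image _ E₀ Subtype.val_injective) rfl).symm
  have h2 : AlgebraicIndependent ℚ (fun e : E₀ => sqLength p e.1.1) ↔
      AlgebraicIndependent ℚ ℓ := by
    rw [← AlgHom.algebraicIndependent_iff (aeval fun z : V × Fin d => p z.1 z.2) hp]
    have : (fun e : E₀ => sqLength p e.1.1) = aeval (fun z : V × Fin d => p z.1 z.2) ∘ ℓ :=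
      _root_.funext fun e => (aeval_lengthPoly_eq_sqLength p _).symm
    rw [this]
  -- Independence passes from numbers to polynomials over `ℚ`, then to `ℂ`, since density is tested
  -- by complex polynomials.
  rw [h1, h2, ← algebraicIndependent_map_iff (L := ℂ), AlgMatroidIndep, zariskiClosure_eq_univ_iff,
    algebraicIndependent_iff]
  refine forall_congr' fun f => imp_congr_left ?_
  have heval : ∀ q : V → Fin d → ℂ, aeval (fun e : E₀ => measurementMap G q e.1) f =
      aeval (fun z : V × Fin d => q z.1 z.2)
        (aeval (fun e => map (algebraMap ℚ ℂ) (ℓ e)) f) := by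
    intro q
    have : (aeval (fun e : E₀ => measurementMap G q e.1) : MvPolynomial E₀ ℂ →ₐ[ℂ] ℂ) =
        (aeval (fun z : V × Fin d => q z.1 z.2)).comp
          (aeval (fun e => map (algebraMap ℚ ℂ) (ℓ e))) := by
      ext e
      simp only [aeval_X, AlgHom.comp_apply, aeval_map_algebraMap, ℓ,
        aeval_lengthPoly_eq_sqLength]
      rfl
    exact DFunLike.congr_fun this f
  constructor
  · intro h
    refine MvPolynomial.funext fun x => ?_
    have hx : (fun e => measurementMap G (fun a i => x (a, i)) e) ∈ measurementVariety d G :=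
      zeroLocus_vanishingIdeal_le _ ⟨_, rfl⟩
    have := h _ ⟨_, hx, rfl⟩
    rw [heval] at this
    simpa using this
  · rintro h _ ⟨x, hx, rfl⟩
    have := hx (rename Subtype.val f) ?_
    · rwa [aeval_rename] at this
    · rintro _ ⟨q, rfl⟩
      rw [aeval_rename]
      exact (heval q).trans (by rw [h, map_zero])

/-- If `{u,v}` is a linked non-adjacent pair, then the squared distance of `u` and `v` in a generic
configuration is algebraic over the squared edge lengths. -/
theorem exists_isAlgebraic_of_rigidityLinked [Finite V] {G : SimpleGraph V} {u v : V}
    (h : RigidityLinked d G u v) (huv : u ≠ v) (hG : ¬ G.Adj u v)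
    {p : V → Fin d → ℂ} (hp : IsGeneric p) :
    ∃ S ⊆ G.edgeSet, IsAlgebraic (Algebra.adjoin ℚ (sqLength p '' S)) (sqDist p u v) := by
  -- Together with nonemptiness, boundedness makes the `sSup` in `ℕ` an attained maximum.
  have hbdd : ∀ H : SimpleGraph V, BddAbove {k | ∃ E₀ : Set H.edgeSet,
      AlgMatroidIndep (measurementVariety d H) E₀ ∧ E₀.ncard = k} := by
    rintro H
    refine ⟨Nat.card H.edgeSet, ?_⟩
    rintro _ ⟨E₀, -, rfl⟩
    exact Set.ncard_le_card E₀
  have hne : {k | ∃ E₀ : Set G.edgeSet,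
      AlgMatroidIndep (measurementVariety d G) E₀ ∧ E₀.ncard = k}.Nonempty := by
    refine ⟨_, ∅, (algMatroidIndep_measurementVariety_iff hp ∅).2 ?_, rfl⟩
    rw [Set.image_empty]
    exact algebraicIndependent_empty_type
  obtain ⟨E₀, hE₀, hcard⟩ := Nat.sSup_mem hne (hbdd G)
  set S : Set (Sym2 V) := Subtype.val '' E₀ with hS
  have hSG : S ⊆ G.edgeSet := by
    rintro _ ⟨e, -, rfl⟩
    exact e.2
  refine ⟨S, hSG, ?_⟩
  -- Otherwise adjoining `uv` to the maximum independent set `S` would raise the rank of `G + uv`.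
  by_contra htr
  have hnot : s(u, v) ∉ S := fun hmem => hG (hSG hmem)
  have hins : AlgebraicIndepOn ℚ (sqLength p) (insert s(u, v) S) :=
    (AlgebraicIndepOn.insert_iff hnot).2
      ⟨(algMatroidIndep_measurementVariety_iff hp E₀).1 hE₀, htr⟩
  have hadj : (addEdge G u v).Adj u v := by
    simp [addEdge, SimpleGraph.edge_adj, huv]
  have hsub : insert s(u, v) S ⊆ (addEdge G u v).edgeSet := by
    refine Set.insert_subset hadj (hSG.trans ?_)
    exact SimpleGraph.edgeSet_mono le_sup_left
  let E₁ : Set (addEdge G u v).edgeSet := Subtype.val ⁻¹' insert s(u, v) S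
  have hE₁ : Subtype.val '' E₁ = insert s(u, v) S := by
    rw [Subtype.image_preimage_coe, Set.inter_eq_right.2 hsub]
  have hind : AlgMatroidIndep (measurementVariety d (addEdge G u v)) E₁ := by
    rw [algMatroidIndep_measurementVariety_iff hp, hE₁]
    exact hins
  have hcard₁ : E₁.ncard = rigidityRank d G + 1 := by
    rw [← Set.ncard_image_of_injective E₁ Subtype.val_injective, hE₁,
      Set.ncard_insert_of_notMem hnot, hS, Set.ncard_image_of_injective _ Subtype.val_injective,
      hcard]
    rfl
  have hle : rigidityRank d G + 1 ≤ rigidityRank d (addEdge G u v) :=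
    le_csSup (hbdd _) ⟨E₁, hind, hcard₁⟩
  rw [h] at hle
  omega

end Matroid

/-! ### Stresses as annihilators of first order length changes. -/

section Weights

variable {V : Type*} {d : ℕ}

open Classical in
/-- An edge weighting as a symmetric matrix. -/
noncomputable def edgeWeight (G : SimpleGraph V) (ω : G.edgeSet → ℂ) (x y : V) : ℂ :=
  if h : G.Adj x y then ω ⟨s(x, y), h⟩ else 0

theorem edgeWeight_of_adj {G : SimpleGraph V} (ω : G.edgeSet → ℂ) {x y : V} (h : G.Adj x y) :
    edgeWeight G ω x y = ω ⟨s(x, y), h⟩ :=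
  dif_pos h

theorem edgeWeight_of_not_adj {G : SimpleGraph V} (ω : G.edgeSet → ℂ) {x y : V}
    (h : ¬ G.Adj x y) : edgeWeight G ω x y = 0 :=
  dif_neg h

theorem edgeWeight_comm (G : SimpleGraph V) (ω : G.edgeSet → ℂ) (x y : V) :
    edgeWeight G ω x y = edgeWeight G ω y x := by
  by_cases h : G.Adj x y
  · rw [edgeWeight_of_adj ω h, edgeWeight_of_adj ω h.symm]
    congr 2
    exact Sym2.eq_swap
  · rw [edgeWeight_of_not_adj ω h, edgeWeight_of_not_adj ω fun h' => h h'.symm]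

/-- A symmetric matrix supported on the edges of `G` comes from an edge weighting. -/
theorem exists_edgeWeight_eq (G : SimpleGraph V) (w : V → V → ℂ) (hw : ∀ x y, w x y = w y x)
    (hG : ∀ x y, ¬ G.Adj x y → w x y = 0) : ∃ ω : G.edgeSet → ℂ, edgeWeight G ω = w := by
  refine ⟨fun e => Sym2.lift ⟨w, hw⟩ e.1, ?_⟩
  ext x y
  by_cases h : G.Adj x y
  · rw [edgeWeight_of_adj _ h]
    rfl
  · rw [edgeWeight_of_not_adj _ h, hG x y h]

theorem edgeWeight_comp {G : SimpleGraph V} (σ : ℂ →+* ℂ) (ω : G.edgeSet → ℂ) (x y : V) :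
    edgeWeight G (fun e => σ (ω e)) x y = σ (edgeWeight G ω x y) := by
  by_cases h : G.Adj x y
  · rw [edgeWeight_of_adj _ h, edgeWeight_of_adj _ h]
  · rw [edgeWeight_of_not_adj _ h, edgeWeight_of_not_adj _ h, map_zero]

variable [Fintype V]

theorem mem_stressSpace_iff {G : SimpleGraph V} {W : Type*} [AddCommGroup W] [Module ℂ W]
    {p : V → W} {ω : G.edgeSet → ℂ} :
    ω ∈ stressSpace G p ↔ ∀ x, ∑ y, edgeWeight G ω x y • (p y - p x) = 0 := by
  refine forall_congr' fun x => ?_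
  refine iff_of_eq (congrArg (· = 0) (Finset.sum_congr rfl fun y _ => ?_))
  by_cases h : G.Adj x y
  · rw [edgeWeight_of_adj ω h, dif_pos h]
  · rw [edgeWeight_of_not_adj ω h, dif_neg h, zero_smul]

theorem mem_stressSpace_pi_iff {G : SimpleGraph V} {p : V → Fin d → ℂ} {ω : G.edgeSet → ℂ} :
    ω ∈ stressSpace G p ↔ ∀ x i, ∑ y, edgeWeight G ω x y * (p y i - p x i) = 0 := by
  rw [mem_stressSpace_iff]
  refine forall_congr' fun x => ?_
  rw [funext_iff]
  refine forall_congr' fun i => ?_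
  simp [Finset.sum_apply]

/-- A stress of a configuration is a common stress of its coordinates. -/
theorem mem_stressSpace_iff_forall_coord {G : SimpleGraph V} {p : V → Fin d → ℂ}
    {ω : G.edgeSet → ℂ} :
    ω ∈ stressSpace G p ↔ ∀ i, ω ∈ stressSpace G fun x => p x i := by
  rw [mem_stressSpace_pi_iff]
  simp only [mem_stressSpace_iff, smul_eq_mul]
  exact forall_comm

/-- Summation by parts: by symmetry of `w`, the `p' x` and `p' y` halves contribute equally, whence
the factor 2. -/
theorem sum_weight_mul_bracket {w : V → V → ℂ} (hw : ∀ x y, w x y = w y x)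
    (p p' : V → Fin d → ℂ) :
    ∑ x, ∑ y, w x y * bracket p p' x y =
      -2 * ∑ x, ∑ i, p' x i * ∑ y, w x y * (p y i - p x i) := by
  have h1 : ∑ x, ∑ y, ∑ i, w x y * ((p x i - p y i) * p' y i) =
      ∑ x, ∑ y, ∑ i, w x y * ((p y i - p x i) * p' x i) := by
    rw [Finset.sum_comm]
    simp only [fun x y => hw y x]
  have h2 : ∑ x, ∑ i, p' x i * ∑ y, w x y * (p y i - p x i) =
      ∑ x, ∑ y, ∑ i, w x y * ((p y i - p x i) * p' x i) := by
    refine Finset.sum_congr rfl fun x _ => ?_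
    rw [Finset.sum_comm]
    refine Finset.sum_congr rfl fun i _ => ?_
    rw [Finset.mul_sum]
    exact Finset.sum_congr rfl fun y _ => by ring
  have h3 : ∑ x, ∑ y, w x y * bracket p p' x y =
      -(∑ x, ∑ y, ∑ i, w x y * ((p y i - p x i) * p' x i)) -
        ∑ x, ∑ y, ∑ i, w x y * ((p x i - p y i) * p' y i) := by
    simp only [bracket, Finset.mul_sum, ← Finset.sum_neg_distrib, ← Finset.sum_sub_distrib]
    refine Finset.sum_congr rfl fun x _ => Finset.sum_congr rfl fun y _ =>
      Finset.sum_congr rfl fun i _ => ?_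
    ring
  rw [h3, h1, h2]
  ring

/-- Stresses form the left kernel of the rigidity matrix; in this form they depend only on the
achievable first order length changes. -/
theorem mem_stressSpace_iff_bracket {G : SimpleGraph V} {p : V → Fin d → ℂ}
    {ω : G.edgeSet → ℂ} :
    ω ∈ stressSpace G p ↔
      ∀ p' : V → Fin d → ℂ, ∑ x, ∑ y, edgeWeight G ω x y * bracket p p' x y = 0 := by
  classical
  rw [mem_stressSpace_pi_iff]
  simp only [sum_weight_mul_bracket (edgeWeight_comm G ω)]
  constructor
  · intro h p'
    simp [h]
  · intro h x i
    have := h (Pi.single x (Pi.single i 1))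
    rw [Finset.sum_eq_single x, Finset.sum_eq_single i] at this
    · simpa using this
    · intro j _ hj
      simp [hj]
    · simp
    · intro y _ hy
      simp [hy]
    · simp

/-- Every stress of a generic configuration is a stress of every equivalent configuration. -/
theorem stressSpace_le_of_equivalent {G : SimpleGraph V} {p q : V → Fin d → ℂ}
    (hp : IsGeneric p) (hpq : Equivalent G p q) : stressSpace G p ≤ stressSpace G q := by
  intro ω hω
  rw [mem_stressSpace_iff_bracket] at hω ⊢
  intro q'
  obtain ⟨p', hp'⟩ := exists_bracket_eq_of_equivalent hp hpq q'
  rw [← hω p']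
  refine Finset.sum_congr rfl fun x _ => Finset.sum_congr rfl fun y _ => ?_
  by_cases h : G.Adj x y
  · rw [hp' x y h]
  · rw [edgeWeight_of_not_adj ω h, zero_mul, zero_mul]

/-- If no first order deformation of `p` changes the squared length of `uv` only, then some stress
does not vanish on `uv`. -/
theorem exists_stress_ne_zero {H : SimpleGraph V} {p : V → Fin d → ℂ} {u v : V}
    (huv : H.Adj u v)
    (h : ∀ p' : V → Fin d → ℂ, (∀ x y, H.Adj x y → s(x, y) ≠ s(u, v) → bracket p p' x y = 0) →
      bracket p p' u v = 0) :
    ∃ ω ∈ stressSpace H p, edgeWeight H ω u v ≠ 0 := by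
  classical
  let R : (V → Fin d → ℂ) →ₗ[ℂ] (V × V → ℂ) :=
    { toFun := fun p' z => if H.Adj z.1 z.2 then bracket p p' z.1 z.2 else 0
      map_add' := fun a b => by
        ext z
        simp only [Pi.add_apply, bracket]
        split_ifs
        · rw [← Finset.sum_add_distrib]
          exact Finset.sum_congr rfl fun i _ => by ring
        · simp
      map_smul' := fun c a => by
        ext z
        simp only [Pi.smul_apply, bracket, smul_eq_mul, RingHom.id_apply]
        split_ifs
        · rw [Finset.mul_sum]
          exact Finset.sum_congr rfl fun i _ => by ring
        · simp }
  -- The length change of `uv` alone is outside the range of the rigidity map `R`. A functional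
  -- killing the range but not `e` yields, after symmetrization, a stress with value `f e` on `uv`.
  let e : V × V → ℂ := Pi.single (u, v) 1 + Pi.single (v, u) 1
  have hne : (u, v) ≠ (v, u) := fun h' => huv.ne (congrArg Prod.fst h')
  have he : e ∉ LinearMap.range R := by
    rintro ⟨p', hp'⟩
    have h0 : bracket p p' u v = 0 := by
      refine h p' fun x y hxy hxyuv => ?_
      have := congrFun hp' (x, y)
      have h1 : (x, y) ≠ (u, v) := fun h' => hxyuv (congrArg (Function.uncurry Sym2.mk) h')
      have h2 : (x, y) ≠ (v, u) := fun h' => hxyuv <|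
        (congrArg (Function.uncurry Sym2.mk) h').trans Sym2.eq_swap
      simpa [R, e, hxy, h1, h2] using this
    have := congrFun hp' (u, v)
    simp [R, e, huv, h0, hne] at this
  obtain ⟨f, hfe, hfR⟩ := Submodule.exists_le_ker_of_notMem he
  let c : V → V → ℂ := fun x y => if H.Adj x y then f (Pi.single (x, y) 1) else 0
  obtain ⟨ω, hω⟩ := exists_edgeWeight_eq H (fun x y => c x y + c y x) (fun x y => add_comm _ _)
    (fun x y hxy => by simp [c, hxy, H.adj_comm y x])
  refine ⟨ω, ?_, ?_⟩
  · rw [mem_stressSpace_iff_bracket]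
    intro p'
    have hf : f (R p') = 0 := hfR ⟨p', rfl⟩
    have hsum : ∑ x, ∑ y, c x y * bracket p p' x y = 0 := by
      rw [← hf, LinearMap.pi_apply_eq_sum_univ f, Fintype.sum_prod_type]
      refine Finset.sum_congr rfl fun x _ => Finset.sum_congr rfl fun y _ => ?_
      have : (fun j => if (x, y) = j then (1 : ℂ) else 0) = Pi.single (x, y) 1 := by
        ext j
        simp [Pi.single_apply, eq_comm]
      by_cases hxy : H.Adj x y
      · simp [c, R, hxy, this, mul_comm]
      · simp [c, R, hxy]
    have hsum' : ∑ x, ∑ y, c y x * bracket p p' x y = 0 := by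
      rw [Finset.sum_comm, ← hsum]
      refine Finset.sum_congr rfl fun x _ => Finset.sum_congr rfl fun y _ => ?_
      congr 1
      exact Finset.sum_congr rfl fun i _ => by ring
    simp only [hω, add_mul, Finset.sum_add_distrib, hsum, hsum', add_zero]
  · rw [hω]
    have : f e = c u v + c v u := by
      simp [e, c, huv, huv.symm]
    exact fun h0 => hfe (this.trans h0)

end Weights

/-! ### The shared stress kernel and the proof over `ℂ`. -/

section Kernel

variable {V : Type*} [Fintype V] {d : ℕ}

theorem comp_mem_stressSpace {G : SimpleGraph V} (σ : ℂ →+* ℂ) {q : V → ℂ} {ω : G.edgeSet → ℂ}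
    (h : ω ∈ stressSpace G q) : (fun e => σ (ω e)) ∈ stressSpace G fun x => σ (q x) := by
  rw [mem_stressSpace_iff] at h ⊢
  intro x
  simpa [edgeWeight_comp] using congrArg σ (h x)

/-- Stress equations have integer coefficients in the weights and coordinates, so field
automorphisms preserve them. This gives a semilinear identification of the kernels of any two
generic configurations. -/
theorem comp_mem_sharedStressKernel {G : SimpleGraph V} (σ : ℂ ≃+* ℂ) {p p' : V → Fin d → ℂ}
    (hσ : ∀ x i, σ (p x i) = p' x i) {q : V → ℂ} (hq : q ∈ sharedStressKernel G p) :
    (fun x => σ (q x)) ∈ sharedStressKernel G p' := by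
  intro ω hω
  have h1 : (fun e => σ.symm (ω e)) ∈ stressSpace G p := by
    rw [mem_stressSpace_iff_forall_coord] at hω ⊢
    intro i
    simpa [← hσ] using comp_mem_stressSpace (σ.symm : ℂ →+* ℂ) (hω i)
  simpa using comp_mem_stressSpace (σ : ℂ →+* ℂ) (hq h1)

/-- The dimension of the shared stress kernel is the same at all generic configurations. -/
theorem finrank_sharedStressKernel_eq {G : SimpleGraph V} {p p' : V → Fin d → ℂ}
    (hp : IsGeneric p) (hp' : IsGeneric p') :
    Module.finrank ℂ (sharedStressKernel G p) = Module.finrank ℂ (sharedStressKernel G p') := by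
  obtain ⟨σ, hσ⟩ := exists_ringEquiv_of_algebraicIndependent hp hp'
  replace hσ : ∀ x i, σ (p x i) = p' x i := fun x i => hσ (x, i)
  let j : sharedStressKernel G p ≃+ sharedStressKernel G p' :=
    { toFun := fun q => ⟨fun x => σ (q.1 x), comp_mem_sharedStressKernel σ hσ q.2⟩
      invFun := fun q => ⟨fun x => σ.symm (q.1 x), comp_mem_sharedStressKernel σ.symm
        (fun x i => by rw [← hσ, RingEquiv.symm_apply_apply]) q.2⟩
      left_inv := fun q => by ext; simp
      right_inv := fun q => by ext; simp
      map_add' := fun a b => by ext; simp }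
  rw [Module.finrank, Module.finrank, rank_eq_of_equiv_equiv σ j σ.bijective
    fun r m => by ext; simp [j]]

theorem sharedStressNullity_eq {G : SimpleGraph V} {p : V → Fin d → ℂ} (hp : IsGeneric p) :
    sharedStressNullity d G = Module.finrank ℂ (sharedStressKernel G p) := by
  obtain ⟨p', hp', h⟩ := Nat.sInf_mem
    (s := {k | ∃ p : V → Fin d → ℂ, IsGeneric p ∧
      Module.finrank ℂ (sharedStressKernel G p) = k}) ⟨_, p, hp, rfl⟩
  exact h.symm.trans (finrank_sharedStressKernel_eq hp' hp)

/-- Extending a stress of `G` by zero gives a stress of `H`, so `H` imposes at least as many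
conditions. -/
theorem sharedStressKernel_anti {G H : SimpleGraph V} (hGH : G ≤ H) (p : V → Fin d → ℂ) :
    sharedStressKernel H p ≤ sharedStressKernel G p := by
  intro q hq ω hω
  obtain ⟨ω', hω'⟩ := exists_edgeWeight_eq H (edgeWeight G ω) (edgeWeight_comm G ω)
    fun x y h => edgeWeight_of_not_adj ω fun h' => h (hGH h')
  have h1 : ω' ∈ stressSpace H p := by
    rw [mem_stressSpace_iff, hω']
    exact mem_stressSpace_iff.1 hω
  have h2 := hq h1
  rwa [mem_stressSpace_iff, hω', ← mem_stressSpace_iff] at h2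

/-- A stress of `(G,p)` is orthogonal to the squared edge lengths. -/
theorem sum_edgeWeight_mul_sqDist {G : SimpleGraph V} {p : V → Fin d → ℂ} {ω : G.edgeSet → ℂ}
    (h : ω ∈ stressSpace G p) : ∑ x, ∑ y, edgeWeight G ω x y * sqDist p x y = 0 := by
  simpa only [sqDist, bracket, sq] using mem_stressSpace_iff_bracket.1 h p

theorem sqDist_eq_of_isStressLinked {G : SimpleGraph V} {u v : V} (h : IsStressLinked d G u v)
    {p q : V → Fin d → ℂ} (hp : IsGeneric p) (hpq : Equivalent G p q) :
    sqDist p u v = sqDist q u v := by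
  have hedge : ∀ x y, G.Adj x y → sqDist p x y = sqDist q x y :=
    fun x y hxy => congrFun hpq ⟨s(x, y), hxy⟩
  rcases eq_or_ne u v with rfl | huv
  · simp [sqDist]
  by_cases hG : G.Adj u v
  · exact hedge u v hG
  set H := addEdge G u v with hH
  have hGH : G ≤ H := le_sup_left
  have hHadj : ∀ x y, H.Adj x y → s(x, y) ≠ s(u, v) → G.Adj x y := by
    intro x y hxy hne
    simp only [hH, addEdge, SimpleGraph.sup_adj, SimpleGraph.edge_adj] at hxy
    rcases hxy with hxy | ⟨hxy, -⟩
    · exact hxy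
    · exact absurd (Sym2.eq_iff.2 (by tauto)) hne
  have hHuv : H.Adj u v := by
    simp [hH, addEdge, SimpleGraph.edge_adj, huv]
  have hker : sharedStressKernel H p = sharedStressKernel G p := by
    refine Submodule.eq_of_le_of_finrank_eq (sharedStressKernel_anti hGH p) ?_
    rw [← sharedStressNullity_eq hp, ← sharedStressNullity_eq hp]
    exact h.2
  obtain ⟨S, hS, halg⟩ := exists_isAlgebraic_of_rigidityLinked h.1 huv hG hp
  -- A deformation fixing all edge lengths of `G` fixes that of `uv`, which is algebraic over them.
  obtain ⟨ω, hω, hωuv⟩ := exists_stress_ne_zero (p := p) hHuv fun p' hp' =>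
    bracket_eq_zero_of_isAlgebraic hp halg p' fun x y hxy => hp' x y (hGH (hS hxy))
      fun hne => hG (by
        have := hS hxy
        rwa [hne] at this)
  have hωq : ω ∈ stressSpace H q := by
    rw [mem_stressSpace_iff_forall_coord]
    intro i
    have hq : (fun x => q x i) ∈ sharedStressKernel H p := by
      rw [hker]
      exact fun η hη =>
        mem_stressSpace_iff_forall_coord.1 (stressSpace_le_of_equivalent hp hpq hη) i
    exact hq hω
  classical
  have hdiff : ∑ x, ∑ y, edgeWeight H ω x y * (sqDist p x y - sqDist q x y) = 0 := by
    simp only [mul_sub, Finset.sum_sub_distrib, sum_edgeWeight_mul_sqDist hω,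
      sum_edgeWeight_mul_sqDist hωq, sub_zero]
  -- Lengths agree on `G`, so only the ordered pairs of `uv` contribute; the sum is a positive
  -- multiple of one term.
  have hconst : ∀ x y, edgeWeight H ω x y * (sqDist p x y - sqDist q x y) =
      if s(x, y) = s(u, v) then edgeWeight H ω u v * (sqDist p u v - sqDist q u v) else 0 := by
    intro x y
    split_ifs with hxy
    · rcases Sym2.eq_iff.1 hxy with ⟨rfl, rfl⟩ | ⟨rfl, rfl⟩
      · rfl
      · rw [edgeWeight_comm, sqDist_comm p, sqDist_comm q]
    · by_cases hxy' : H.Adj x y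
      · rw [hedge x y (hHadj x y hxy' hxy), sub_self, mul_zero]
      · rw [edgeWeight_of_not_adj ω hxy', zero_mul]
  rw [Finset.sum_congr rfl fun x _ => Finset.sum_congr rfl fun y _ => hconst x y,
    ← Fintype.sum_prod_type', ← Finset.sum_filter, Finset.sum_const, smul_eq_zero,
    Finset.card_eq_zero, mul_eq_zero, sub_eq_zero] at hdiff
  refine (hdiff.resolve_left ?_).resolve_left hωuv
  exact Finset.ne_empty_of_mem (a := (u, v)) (by simp)

end Kernel

/-! ### Descent to `ℝ` and the main theorem. -/

/-- A pair that is globally linked over `ℂ` is globally linked over `ℝ`. -/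
theorem GloballyLinked.real_of_complex {V : Type*} {d : ℕ} {G : SimpleGraph V} {u v : V}
    (h : GloballyLinked ℂ d G u v) : GloballyLinked ℝ d G u v := by
  intro p q hp hpq
  have hcast : ∀ (r : V → Fin d → ℝ) x y,
      sqDist (fun x i => (r x i : ℂ)) x y = ((sqDist r x y : ℝ) : ℂ) := by
    intro r x y
    simp [sqDist]
  have hgen : IsGeneric fun x i => (p x i : ℂ) :=
    AlgebraicIndependent.map' (f := (Complex.ofRealHom).toRatAlgHom) hp Complex.ofReal_injective
  have heq : Equivalent G (fun x i => (p x i : ℂ)) (fun x i => (q x i : ℂ)) := by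
    funext ⟨e, he⟩
    induction e with
    | _ x y =>
      have h1 : sqDist p x y = sqDist q x y := congrFun hpq ⟨s(x, y), he⟩
      change sqDist (fun x i => (p x i : ℂ)) x y = sqDist (fun x i => (q x i : ℂ)) x y
      rw [hcast, hcast, h1]
  have := h _ _ hgen heq
  rw [hcast, hcast] at this
  exact_mod_cast this

end StressLinked

theorem mainTheorem1 {V : Type*} [Fintype V] (d : ℕ) (G : SimpleGraph V) (u v : V)
    (h : StressLinked.IsStressLinked d G u v) :
    StressLinked.GloballyLinked ℂ d G u v ∧ StressLinked.GloballyLinked ℝ d G u v := by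
  have hC : StressLinked.GloballyLinked ℂ d G u v := fun _ _ hp hpq =>
    StressLinked.sqDist_eq_of_isStressLinked h hp hpq
  exact ⟨hC, hC.real_of_complex⟩
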